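/- Let $n\ge 0$, let $|z|$ denote the Euclidean norm on $\mathbf{C}^n$, and for $A>0$ let $E_A$ be the Banach space of entire functions $f$ on $\mathbf{C}^n$ with $$\|f\|_A=\sup_{z\in\mathbf{C}^n}|f(z)|e^{-A|z|}<\infty .$$ Let $\mathrm{Exp}(\mathbf{C}^n)=\bigcup_{A>0}E_A$ be the algebra of entire functions of exponential type, with pointwise operations, equipped with the locally convex inductive limit topology of $\operatorname{ind\,lim}_{A>0}E_A$, i.e. the finest locally convex vector space topology for which all the inclusions $E_A\to\mathrm{Exp}(\mathbf{C}^n)$, $A>0$, are continuous. Then for every polynomial $p\in\mathbf{C}[z_1,\dots,z_n]$ the multiplication map $$\sigma_p:\mathrm{Exp}(\mathbf{C}^n)\to\mathrm{Exp}(\mathbf{C}^n),\qquad f\mapsto pf,$$ is continuous and is a closed map, that is, it maps every closed subset of $\mathrm{Exp}(\mathbf{C}^n)$ to a closed subset. In particular the principal ideal $p\cdot\mathrm{Exp}(\mathbf{C}^n)$ generated by $p$ is closed in $\mathrm{Exp}(\mathbf{C}^n)$. -/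

import Mathlib

noncomputable section

namespace ExpType

/-- The space `E_A` of entire functions `f` on `ℂⁿ` (with the Euclidean norm) such that
`|f(z)| exp(-A|z|)` is bounded, as a linear subspace of the space of all functions. -/
def growthSubmodule (n : ℕ) (A : ℝ) : Submodule ℂ (EuclideanSpace ℂ (Fin n) → ℂ) where
  carrier := {f | Differentiable ℂ f ∧
    BddAbove (Set.range fun z => ‖f z‖ * Real.exp (-A * ‖z‖))}
  zero_mem' := by
    refine ⟨differentiable_const 0, 0, ?_⟩
    rintro _ ⟨z, rfl⟩
    simp
  add_mem' := by
    rintro f g ⟨hf, C, hC⟩ ⟨hg, D, hD⟩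
    refine ⟨hf.add hg, C + D, ?_⟩
    rintro _ ⟨z, rfl⟩
    have h1 := hC ⟨z, rfl⟩
    have h2 := hD ⟨z, rfl⟩
    have h3 := mul_le_mul_of_nonneg_right (norm_add_le (f z) (g z))
      (Real.exp_nonneg (-A * ‖z‖))
    simp only [Pi.add_apply] at *
    linarith
  smul_mem' := by
    rintro c f ⟨hf, C, hC⟩
    refine ⟨hf.const_smul c, ‖c‖ * C, ?_⟩
    rintro _ ⟨z, rfl⟩
    have h1 := mul_le_mul_of_nonneg_left (hC ⟨z, rfl⟩) (norm_nonneg c)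
    simpa [mul_assoc] using h1

/-- The type `E_A`. It is a separate type so that it carries only the topology of the
norm `‖f‖_A` below, not the topology of pointwise convergence. -/
def E (n : ℕ) (A : ℝ) : Type := growthSubmodule n A

instance (n : ℕ) (A : ℝ) : AddCommGroup (E n A) :=
  inferInstanceAs (AddCommGroup (growthSubmodule n A))

instance (n : ℕ) (A : ℝ) : Module ℂ (E n A) :=
  inferInstanceAs (Module ℂ (growthSubmodule n A))

/-- The norm `‖f‖_A = sup_z |f(z)| exp(-A|z|)`. -/
instance (n : ℕ) (A : ℝ) : Norm (E n A) where
  norm f := ⨆ z, ‖f.1 z‖ * Real.exp (-A * ‖z‖)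

theorem E.norm_core (n : ℕ) (A : ℝ) : NormedSpace.Core ℂ (E n A) where
  norm_nonneg f := Real.iSup_nonneg fun z => by positivity
  norm_smul c f := by
    change (⨆ z, ‖c * f.1 z‖ * Real.exp (-A * ‖z‖)) = ‖c‖ * ⨆ z, ‖f.1 z‖ * Real.exp (-A * ‖z‖)
    rw [Real.mul_iSup_of_nonneg (norm_nonneg c)]
    simp only [norm_mul, mul_assoc]
  norm_triangle f g := by
    refine ciSup_le fun z => ?_
    have h1 := le_ciSup f.2.2 z
    have h2 := le_ciSup g.2.2 z
    have h3 := mul_le_mul_of_nonneg_right (norm_add_le (f.1 z) (g.1 z))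
      (Real.exp_nonneg (-A * ‖z‖))
    change ‖f.1 z + g.1 z‖ * _ ≤ (⨆ z, ‖f.1 z‖ * Real.exp (-A * ‖z‖)) +
      ⨆ z, ‖g.1 z‖ * Real.exp (-A * ‖z‖)
    linarith
  norm_eq_zero_iff f := by
    constructor
    · intro h
      refine Subtype.ext (funext fun z => ?_)
      have h1 : ‖f.1 z‖ * Real.exp (-A * ‖z‖) ≤ ‖f‖ := le_ciSup f.2.2 z
      rw [h] at h1
      have h2 : ‖f.1 z‖ ≤ 0 := nonpos_of_mul_nonpos_left h1 (Real.exp_pos _)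
      exact norm_le_zero_iff.1 h2
    · rintro rfl
      change (⨆ z : EuclideanSpace ℂ (Fin n), ‖(0 : ℂ)‖ * Real.exp (-A * ‖z‖)) = 0
      simp

instance (n : ℕ) (A : ℝ) : NormedAddCommGroup (E n A) :=
  NormedAddCommGroup.ofCore (E.norm_core n A)

instance (n : ℕ) (A : ℝ) : NormedSpace ℂ (E n A) :=
  NormedSpace.ofCore (E.norm_core n A)

theorem const_mem_growth (n : ℕ) {A : ℝ} (hA : 0 < A) (c : ℂ) :
    (fun _ => c) ∈ growthSubmodule n A := by
  refine ⟨differentiable_const c, ‖c‖, ?_⟩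
  rintro _ ⟨z, rfl⟩
  refine mul_le_of_le_one_right (norm_nonneg c) (Real.exp_le_one_iff.2 ?_)
  nlinarith [mul_nonneg hA.le (norm_nonneg z)]

theorem mul_mem_growth {n : ℕ} {A B : ℝ} {f g : EuclideanSpace ℂ (Fin n) → ℂ}
    (hf : f ∈ growthSubmodule n A) (hg : g ∈ growthSubmodule n B) :
    f * g ∈ growthSubmodule n (A + B) := by
  obtain ⟨hf, C, hC⟩ := hf
  obtain ⟨hg, D, hD⟩ := hg
  refine ⟨hf.mul hg, C * D, ?_⟩
  rintro _ ⟨z, rfl⟩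
  have h1 : ‖f z‖ * Real.exp (-A * ‖z‖) ≤ C := hC ⟨z, rfl⟩
  have h2 : ‖g z‖ * Real.exp (-B * ‖z‖) ≤ D := hD ⟨z, rfl⟩
  have h3 := mul_le_mul h1 h2 (by positivity) (le_trans (by positivity) h1)
  refine le_trans (le_of_eq ?_) h3
  have : -(A + B) * ‖z‖ = -A * ‖z‖ + -B * ‖z‖ := by ring
  simp only [Pi.mul_apply, norm_mul, this, Real.exp_add]
  ring

theorem growth_mono (n : ℕ) {A B : ℝ} (h : A ≤ B) :
    growthSubmodule n A ≤ growthSubmodule n B := by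
  rintro f ⟨hf, C, hC⟩
  refine ⟨hf, C, ?_⟩
  rintro _ ⟨z, rfl⟩
  refine le_trans (mul_le_mul_of_nonneg_left (Real.exp_le_exp.2 ?_) (norm_nonneg _))
    (hC ⟨z, rfl⟩)
  nlinarith [norm_nonneg z]

/-- The algebra of entire functions of exponential type: the union of the `E_A`, `A > 0`,
with pointwise operations. -/
def expSubalgebra (n : ℕ) : Subalgebra ℂ (EuclideanSpace ℂ (Fin n) → ℂ) where
  carrier := {f | ∃ A : ℝ, 0 < A ∧ f ∈ growthSubmodule n A}
  mul_mem' := by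
    rintro f g ⟨A, hA, hf⟩ ⟨B, hB, hg⟩
    exact ⟨A + B, add_pos hA hB, mul_mem_growth hf hg⟩
  add_mem' := by
    rintro f g ⟨A, hA, hf⟩ ⟨B, hB, hg⟩
    exact ⟨max A B, lt_max_of_lt_left hA, Submodule.add_mem _
      (growth_mono n (le_max_left A B) hf) (growth_mono n (le_max_right A B) hg)⟩
  algebraMap_mem' c := ⟨1, one_pos, const_mem_growth n one_pos c⟩

/-- The type `Exp(ℂⁿ)`. It is a separate type so that it carries only the inductive limit
topology defined below. -/
def Exp (n : ℕ) : Type := expSubalgebra n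

instance (n : ℕ) : CommRing (Exp n) := inferInstanceAs (CommRing (expSubalgebra n))

instance (n : ℕ) : Algebra ℂ (Exp n) := inferInstanceAs (Algebra ℂ (expSubalgebra n))

/-- The function underlying an element of `Exp(ℂⁿ)`. -/
instance (n : ℕ) : CoeFun (Exp n) (fun _ => EuclideanSpace ℂ (Fin n) → ℂ) where
  coe f := f.1

/-- The inclusion `E_A → Exp(ℂⁿ)`, for `A > 0`. -/
def incl (n : ℕ) (A : ℝ) (hA : 0 < A) : E n A →ₗ[ℂ] Exp n where
  toFun f := ⟨f.1, A, hA, f.2⟩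
  map_add' _ _ := rfl
  map_smul' _ _ := rfl

/-- `t` is a locally convex vector space topology on `Exp(ℂⁿ)` for which every inclusion
`E_A → Exp(ℂⁿ)`, `A > 0`, is continuous. -/
def IsCompatible (n : ℕ) (t : TopologicalSpace (Exp n)) : Prop :=
  @IsTopologicalAddGroup (Exp n) t _ ∧
  @ContinuousSMul ℂ (Exp n) _ _ t ∧
  @LocallyConvexSpace ℝ (Exp n) _ _ _ (Module.complexToReal (Exp n)) t ∧
  ∀ (A : ℝ) (hA : 0 < A), @Continuous (E n A) (Exp n) _ t (incl n A hA)

/-- The (locally convex) inductive limit topology on `Exp(ℂⁿ) = ind lim E_A`: the finest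
locally convex vector space topology for which every inclusion `E_A → Exp(ℂⁿ)` is continuous.
In Mathlib's order on topologies finer means smaller, so this is an infimum. -/
instance expTopology (n : ℕ) : TopologicalSpace (Exp n) := sInf {t | IsCompatible n t}

/-- The infimum is attained, so that the inductive limit topology is itself a locally convex
vector space topology for which the inclusions are continuous. -/
theorem isCompatible_expTopology (n : ℕ) : IsCompatible n (expTopology n) := by
  refine ⟨topologicalAddGroup_sInf fun t ht => ht.1, continuousSMul_sInf fun t ht => ht.2.1,
    ?_, fun A hA => ?_⟩
  · let _ := Module.complexToReal (Exp n)
    exact LocallyConvexSpace.sInf fun t ht => ht.2.2.1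
  · exact continuous_sInf_rng.2 fun t ht => ht.2.2.2 A hA

theorem coord_mem (n : ℕ) (i : Fin n) :
    (fun z : EuclideanSpace ℂ (Fin n) => z i) ∈ expSubalgebra n := by
  refine ⟨1, one_pos, by fun_prop, 1, ?_⟩
  rintro _ ⟨z, rfl⟩
  have h1 : ‖z i‖ ≤ ‖z‖ := PiLp.norm_apply_le z i
  have h2 : ‖z‖ ≤ Real.exp ‖z‖ := by linarith [Real.add_one_le_exp ‖z‖]
  have h3 := mul_le_mul_of_nonneg_right (h1.trans h2) (Real.exp_nonneg (-1 * ‖z‖))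
  rw [← Real.exp_add] at h3
  simpa using h3

theorem eval_mem (n : ℕ) (p : MvPolynomial (Fin n) ℂ) :
    (fun z : EuclideanSpace ℂ (Fin n) => MvPolynomial.eval (fun i => z i) p) ∈
      expSubalgebra n := by
  induction p using MvPolynomial.induction_on with
  | C a => simpa only [MvPolynomial.eval_C] using! (expSubalgebra n).algebraMap_mem a
  | add p q hp hq => simpa using! (expSubalgebra n).add_mem hp hq
  | mul_X p i hp => simpa using! (expSubalgebra n).mul_mem hp (coord_mem n i)

/-- A polynomial on `ℂⁿ`, regarded as an entire function of exponential type. -/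
def ofPolynomial {n : ℕ} (p : MvPolynomial (Fin n) ℂ) : Exp n :=
  ⟨fun z => MvPolynomial.eval (fun i => z i) p, eval_mem n p⟩

/-- The multiplication map `σ_p : f ↦ p f` on `Exp(ℂⁿ)`. -/
def sigma {n : ℕ} (p : MvPolynomial (Fin n) ℂ) (f : Exp n) : Exp n := ofPolynomial p * f

end ExpType

end

/-! `Exp n` is an inductive limit of Banach spaces with compact linking maps. For such limits a set
is open, hence also closed, as soon as its traces on all `E n A` are
(`isOpen_of_isOpen_preimage_incl`). This reduces the theorem to sequences in a single `E n A`.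

Let `C` be closed, `g k ∈ C`, and `p * g k → f` in `E n A`. The products are bounded in `E n A`, and
division by `p ≠ 0` is bounded there: by Malgrange's inequality `|g z|` is controlled by `|p g|` on
a circle `z + t v` whose size does not depend on `z`. So the `g k` are bounded in `E n A`, and
Montel's theorem (`isCompact_image_inclusion_closedBall`) gives a subsequence converging in `E n (A
+ 1)` to some `h`. Then `h ∈ C`, and `p * h = f` because `sigma p` is continuous and `Exp n` is
Hausdorff. -/

open Set Filter Topology Metric

/-! ### Normal families of entire functions -/

section EntireFunctions

variable {X : Type*} [NormedAddCommGroup X] [NormedSpace ℂ X]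

/-- Cauchy's estimate for the derivative of an entire function on a normed space. -/
theorem Differentiable.norm_fderiv_le_of_closedBall {f : X → ℂ} (hf : Differentiable ℂ f)
    {z : X} {M : ℝ} (hM : ∀ w ∈ closedBall z 1, ‖f w‖ ≤ M) : ‖fderiv ℂ f z‖ ≤ M := by
  have hM0 : 0 ≤ M := (norm_nonneg _).trans (hM z (mem_closedBall_self zero_le_one))
  refine ContinuousLinearMap.opNorm_le_bound _ hM0 fun v => ?_
  rcases eq_or_ne v 0 with rfl | hv
  · simp
  have hv' : 0 < ‖v‖ := norm_pos_iff.2 hv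
  have hline (t : ℂ) : HasDerivAt (fun t : ℂ => f (z + t • v)) (fderiv ℂ f (z + t • v) v) t := by
    have h2 : HasDerivAt (fun t : ℂ => z + t • v) v t := by
      simpa using ((hasDerivAt_id t).smul_const v).const_add z
    exact (hf (z + t • v)).hasFDerivAt.comp_hasDerivAt t h2
  have hderiv := (hline 0).deriv
  rw [zero_smul, add_zero] at hderiv
  -- With radius `‖v‖⁻¹` the circle `z + t • v` stays at distance 1 from `z`.
  have h := Complex.norm_deriv_le_of_forall_mem_sphere_norm_le (c := 0) (R := ‖v‖⁻¹) (C := M)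
    (f := fun t : ℂ => f (z + t • v)) (inv_pos.2 hv')
    (Differentiable.diffContOnCl fun t => (hline t).differentiableAt) fun t ht => hM _ (by
      rw [mem_sphere_zero_iff_norm] at ht
      rw [mem_closedBall, dist_eq_norm, add_sub_cancel_left, norm_smul, ht,
        inv_mul_cancel₀ hv'.ne'])
  rwa [hderiv, div_inv_eq_mul] at h

/-- **Weierstrass' theorem**: a locally uniform limit of entire functions on a normed space is
entire. -/
theorem TendstoUniformlyOn.differentiable_of_closedBall {ι : Type*} {l : Filter ι} [l.NeBot]
    {F : ι → X → ℂ} {g : X → ℂ} (hF : ∀ i, Differentiable ℂ (F i))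
    (h : ∀ R, TendstoUniformlyOn F g l (closedBall 0 R)) : Differentiable ℂ g := by
  have hpt (z : X) : Tendsto (fun i => F i z) l (𝓝 (g z)) :=
    (h ‖z‖).tendsto_at (by simp)
  intro x
  -- Cauchy's estimate for `F i - F j`; unit balls around points of `ball x 1` lie within radius
  -- `‖x‖ + 2`.
  have hC : UniformCauchySeqOn (fun i => fderiv ℂ (F i)) l (ball x 1) := by
    intro u hu
    obtain ⟨ε, hε, hεu⟩ := Metric.mem_uniformity_dist.1 hu
    have hU := (h (‖x‖ + 2)).uniformCauchySeqOn _ (dist_mem_uniformity (half_pos hε))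
    filter_upwards [hU] with m hm z hz
    refine hεu (lt_of_le_of_lt ?_ (half_lt_self hε))
    rw [dist_eq_norm, ← fderiv_sub (hF m.1 z) (hF m.2 z)]
    refine ((hF m.1).sub (hF m.2)).norm_fderiv_le_of_closedBall fun w hw => ?_
    rw [Pi.sub_apply, ← dist_eq_norm]
    refine (hm w ?_).le
    rw [mem_ball, dist_eq_norm] at hz
    rw [mem_closedBall, dist_eq_norm] at hw
    rw [mem_closedBall_zero_iff]
    have h1 := norm_add_le (w - z) z
    have h2 := norm_add_le (z - x) x
    rw [sub_add_cancel] at h1 h2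
    linarith
  have hlim : ∀ z : X, ∃ L, z ∈ ball x 1 → Tendsto (fun i => fderiv ℂ (F i) z) l (𝓝 L) := by
    intro z
    by_cases hz : z ∈ ball x 1
    · obtain ⟨L, hL⟩ := cauchy_iff_exists_le_nhds.1 (hC.cauchy_map hz)
      exact ⟨L, fun _ => hL⟩
    · exact ⟨0, fun h => absurd h hz⟩
  choose g' hg' using hlim
  exact (hasFDerivAt_of_tendstoUniformlyOn isOpen_ball
    (hC.tendstoUniformlyOn_of_tendsto fun z hz => hg' z hz)
    (fun i z _ => (hF i z).hasFDerivAt) (fun z _ => hpt z) (mem_ball_self one_pos)).differentiableAt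

/-- The set of entire functions with `‖f z‖ ≤ r * exp (A * ‖z‖)`. -/
def growthBall (X : Type*) [NormedAddCommGroup X] [NormedSpace ℂ X] (A r : ℝ) : Set (X → ℂ) :=
  {f | Differentiable ℂ f ∧ ∀ z, ‖f z‖ ≤ r * Real.exp (A * ‖z‖)}

/-- Cauchy's estimate bounds all the derivatives near `x` by one constant, hence a common Lipschitz
constant. -/
theorem equicontinuous_growthBall {A r : ℝ} (hA : 0 ≤ A) (hr : 0 ≤ r) :
    Equicontinuous ((↑) : growthBall X A r → X → ℂ) := by
  intro x
  set M := r * Real.exp (A * (‖x‖ + 2))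
  have hM : 0 ≤ M := by positivity
  have hlip (f : growthBall X A r) (y : X) (hy : y ∈ ball x 1) :
      dist (f.1 x) (f.1 y) ≤ M * dist y x := by
    rw [dist_comm, dist_eq_norm, dist_eq_norm]
    refine (convex_ball x 1).norm_image_sub_le_of_norm_fderiv_le (𝕜 := ℂ)
      (fun z _ => f.2.1 z) (fun z hz => ?_) (mem_ball_self one_pos) hy
    refine f.2.1.norm_fderiv_le_of_closedBall fun w hw => (f.2.2 w).trans ?_
    refine mul_le_mul_of_nonneg_left (Real.exp_le_exp.2 (mul_le_mul_of_nonneg_left ?_ hA)) hr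
    rw [mem_ball, dist_eq_norm] at hz
    rw [mem_closedBall, dist_eq_norm] at hw
    have h1 := norm_add_le (w - z) z
    have h2 := norm_add_le (z - x) x
    rw [sub_add_cancel] at h1 h2
    linarith
  refine Metric.equicontinuousAt_of_continuity_modulus (fun y => M * dist y x) ?_ _ ?_
  · have : Tendsto (fun y => M * dist y x) (𝓝 x) (𝓝 (M * dist x x)) :=
      ((continuous_id.dist continuous_const).const_mul M).tendsto x
    simpa using this
  · filter_upwards [ball_mem_nhds x one_pos] with y hy f using hlip f y hy

variable [ProperSpace X]

/-- By equicontinuity, pointwise convergence is the same as convergence on compact sets. -/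
theorem tendstoUniformlyOn_of_growthBall {A r : ℝ} (hA : 0 ≤ A) (hr : 0 ≤ r) {ι : Type*}
    {l : Filter ι} {F : ι → growthBall X A r} {g : X → ℂ}
    (h : Tendsto (fun i => (F i).1) l (𝓝 g)) (R : ℝ) :
    TendstoUniformlyOn (fun i => (F i).1) g l (closedBall 0 R) := by
  have hE : Equicontinuous (fun i => (F i).1) := (equicontinuous_growthBall hA hr).comp F
  have hcov : ⋃₀ {K : Set X | IsCompact K} = univ :=
    eq_univ_of_forall fun x => ⟨{x}, isCompact_singleton, rfl⟩
  have := (EquicontinuousOn.tendsto_uniformOnFun_iff_pi (𝔖 := {K : Set X | IsCompact K})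
    (fun K hK => hK) hcov (fun K _ => hE.equicontinuousOn K) l g).2 h
  exact UniformOnFun.tendsto_iff_tendstoUniformlyOn.1 this _ (isCompact_closedBall 0 R)

/-- Compactness is for pointwise convergence: the set lies in a product of discs, compact by
Tychonoff, and is closed there by Weierstrass' theorem. -/
theorem isCompact_growthBall {A r : ℝ} (hA : 0 ≤ A) (hr : 0 ≤ r) :
    IsCompact (growthBall X A r) := by
  refine (isCompact_univ_pi fun z : X => isCompact_closedBall (0 : ℂ)
    (r * Real.exp (A * ‖z‖))).of_isClosed_subset ?_ fun f hf z _ => by simpa using hf.2 z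
  rw [isClosed_iff_forall_filter]
  intro g l hl hlT hlg
  have hmem : ∀ᶠ f in l, f ∈ growthBall X A r := hlT (mem_principal_self _)
  have : NeBot (comap ((↑) : growthBall X A r → X → ℂ) l) :=
    comap_coe_neBot_of_le_principal hlT
  have ht : Tendsto (fun f : growthBall X A r => f.1) (comap (↑) l) (𝓝 g) :=
    tendsto_comap.mono_right hlg
  refine ⟨TendstoUniformlyOn.differentiable_of_closedBall (fun f : growthBall X A r => f.2.1)
    (tendstoUniformlyOn_of_growthBall (F := id) hA hr ht), fun z => ?_⟩
  exact le_of_tendsto' ((tendsto_pi_nhds.1 ht z).norm) fun f => f.2.2 z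

end EntireFunctions

/-! ### Compactness of the inclusions between the spaces `E n A` -/

namespace ExpType

variable {n : ℕ} {A B : ℝ}

theorem E.norm_apply_le (f : E n A) (z : EuclideanSpace ℂ (Fin n)) :
    ‖f.1 z‖ ≤ ‖f‖ * Real.exp (A * ‖z‖) := by
  have h : ‖f.1 z‖ * Real.exp (-A * ‖z‖) ≤ ‖f‖ := le_ciSup f.2.2 z
  rw [neg_mul, Real.exp_neg] at h
  exact (le_div_iff₀ (inv_pos.2 (Real.exp_pos _))).2 h |>.trans_eq (div_inv_eq_mul _ _)

theorem E.norm_le_of_apply_le {f : E n A} {r : ℝ}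
    (h : ∀ z, ‖f.1 z‖ ≤ r * Real.exp (A * ‖z‖)) : ‖f‖ ≤ r := by
  refine ciSup_le fun z => ?_
  rw [neg_mul, Real.exp_neg]
  exact (mul_inv_le_iff₀ (Real.exp_pos _)).2 (h z)

theorem mem_growthSubmodule_of_growthBall {f : EuclideanSpace ℂ (Fin n) → ℂ} {r : ℝ}
    (h : f ∈ growthBall (EuclideanSpace ℂ (Fin n)) A r) : f ∈ growthSubmodule n A := by
  refine ⟨h.1, r, ?_⟩
  rintro _ ⟨z, rfl⟩
  change ‖f z‖ * Real.exp (-A * ‖z‖) ≤ r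
  rw [neg_mul, Real.exp_neg]
  exact (mul_inv_le_iff₀ (Real.exp_pos _)).2 (h.2 z)

/-- The inclusion `E_A → E_B` for `A ≤ B`. -/
noncomputable def E.inclusion (n : ℕ) {A B : ℝ} (h : A ≤ B) : E n A →L[ℂ] E n B :=
  LinearMap.mkContinuous (Submodule.inclusion (growth_mono n h) : E n A →ₗ[ℂ] E n B) 1 fun f => by
    rw [one_mul]
    refine E.norm_le_of_apply_le fun z => (E.norm_apply_le f z).trans ?_
    gcongr

/-- **Montel's theorem** for the spaces `E_A`: for `A < B`, closed balls of `E_A` are compact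
in `E_B`. -/
theorem isCompact_image_inclusion_closedBall (hA : 0 ≤ A) (h : A < B) (r : ℝ) :
    IsCompact (E.inclusion n h.le '' closedBall 0 r) := by
  rcases lt_or_ge r 0 with hr | hr
  · simp [closedBall_eq_empty.2 hr]
  set T := growthBall (EuclideanSpace ℂ (Fin n)) A r
  have : CompactSpace T := isCompact_iff_compactSpace.1 (isCompact_growthBall hA hr)
  let j : T → E n B := fun f =>
    E.inclusion n h.le ⟨f.1, mem_growthSubmodule_of_growthBall f.2⟩
  have himage : E.inclusion n h.le '' closedBall 0 r = range j := by
    ext g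
    constructor
    · rintro ⟨f, hf, rfl⟩
      rw [mem_closedBall_zero_iff] at hf
      exact ⟨⟨f.1, f.2.1, fun z => (E.norm_apply_le f z).trans (by gcongr)⟩, rfl⟩
    · rintro ⟨f, rfl⟩
      exact ⟨_, mem_closedBall_zero_iff.2 (E.norm_le_of_apply_le f.2.2), rfl⟩
  rw [himage]
  refine isCompact_range (continuous_iff_continuousAt.2 fun f => ?_)
  rw [ContinuousAt, tendsto_iff_norm_sub_tendsto_zero, Metric.tendsto_nhds]
  intro δ hδ
  -- Outside radius `R` the stronger weight makes the difference small; inside, uniform convergence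
  -- does.
  have hR : ∀ᶠ R in atTop, 2 * r * Real.exp (-((B - A) * R)) < δ / 2 := by
    have : Tendsto (fun R => 2 * r * Real.exp (-((B - A) * R))) atTop (𝓝 (2 * r * 0)) :=
      ((Real.tendsto_exp_neg_atTop_nhds_zero.comp
        (tendsto_id.const_mul_atTop (sub_pos.2 h)))).const_mul _
    rw [mul_zero] at this
    exact this.eventually_lt_const (half_pos hδ)
  obtain ⟨R, hR⟩ := hR.exists
  have hu := tendstoUniformlyOn_of_growthBall (F := id) hA hr (continuous_subtype_val.tendsto f) R
  filter_upwards [Metric.tendstoUniformlyOn_iff.1 hu _ (half_pos hδ)] with g hg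
  rw [dist_zero_right, norm_norm]
  refine lt_of_le_of_lt (E.norm_le_of_apply_le (r := δ / 2) fun z => ?_) (half_lt_self hδ)
  change ‖g.1 z - f.1 z‖ ≤ _
  rcases le_or_gt ‖z‖ R with hz | hz
  · have h1 := hg z (mem_closedBall_zero_iff.2 hz)
    rw [dist_comm, dist_eq_norm] at h1
    refine h1.le.trans (le_mul_of_one_le_right (half_pos hδ).le (Real.one_le_exp ?_))
    have := hA.trans h.le
    positivity
  · have h1 : ‖g.1 z - f.1 z‖ ≤ 2 * r * Real.exp (A * ‖z‖) := by
      linarith [norm_sub_le (g.1 z) (f.1 z), g.2.2 z, f.2.2 z]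
    have h2 : Real.exp (A * ‖z‖) ≤ Real.exp (-((B - A) * R)) * Real.exp (B * ‖z‖) := by
      rw [← Real.exp_add]
      refine Real.exp_le_exp.2 ?_
      nlinarith [mul_le_mul_of_nonneg_left hz.le (sub_pos.2 h).le]
    calc ‖g.1 z - f.1 z‖ ≤ 2 * r * Real.exp (A * ‖z‖) := h1
      _ ≤ 2 * r * (Real.exp (-((B - A) * R)) * Real.exp (B * ‖z‖)) := by gcongr
      _ = 2 * r * Real.exp (-((B - A) * R)) * Real.exp (B * ‖z‖) := by ring
      _ ≤ δ / 2 * Real.exp (B * ‖z‖) := by gcongr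

end ExpType

/-! ### Inductive limits with compact linking maps -/

section CompactSteps

open scoped Pointwise

variable {G : Type*} [AddCommGroup G] [Module ℂ G] {E : ℕ → Type*}
  [∀ k, NormedAddCommGroup (E k)] [∀ k, NormedSpace ℂ (E k)]

theorem Balanced.image_linearMap {V W : Type*} [AddCommGroup V] [Module ℂ V] [AddCommGroup W]
    [Module ℂ W] {s : Set V} (hs : Balanced ℂ s) (f : V →ₗ[ℂ] W) : Balanced ℂ (f '' s) := by
  rintro a ha _ ⟨_, ⟨x, hx, rfl⟩, rfl⟩
  exact ⟨a • x, hs a ha (smul_mem_smul_set hx), map_smul f a x⟩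

/-- In an increasing sequence of normed spaces with compact linking maps, a set whose trace on each
step is an open neighbourhood of `0` contains the open unit ball of a seminorm which is continuous
on each step. -/
theorem exists_seminorm_ball_subset_of_compact_steps (j : ∀ k, E k →ₗ[ℂ] G)
    (s : ∀ k, E k →L[ℂ] E (k + 1)) (hs : ∀ k x, j (k + 1) (s k x) = j k x)
    (hcompact : ∀ k r, IsCompact (s k '' closedBall 0 r)) (hj : ∀ g, ∃ k x, j k x = g)
    {U : Set G} (hU : ∀ k, IsOpen (j k ⁻¹' U)) (h0 : 0 ∈ U) :
    ∃ p : Seminorm ℂ G, (∀ k, Continuous (p.comp (j k))) ∧ p.ball 0 1 ⊆ U := by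
  let P (k : ℕ) (C : Set (E k)) : Prop :=
    IsCompact C ∧ Convex ℝ C ∧ Balanced ℂ C ∧ 0 ∈ C ∧ C ⊆ j k ⁻¹' U
  have step (k : ℕ) (C : Set (E k)) (hC : P k C) :
      -- A compact set in an open one leaves room for a ball; the enlarged set becomes compact again
      -- one step later.
      ∃ ε > 0, P (k + 1) (s k '' (C + closedBall 0 ε)) := by
    obtain ⟨h1, h2, h3, h4, h5⟩ := hC
    obtain ⟨ε, hε, hsub⟩ := h1.exists_cthickening_subset_open (hU k) h5
    rw [← h1.add_closedBall_zero hε.le] at hsub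
    refine ⟨ε, hε, ?_, ?_, ?_, ?_, ?_⟩
    · rw [image_add]
      exact (h1.image (s k).continuous).add (hcompact k ε)
    · exact (h2.add (convex_closedBall 0 ε)).linear_image ((s k).toLinearMap.restrictScalars ℝ)
    · exact (h3.add balanced_closedBall_zero).image_linearMap (s k).toLinearMap
    · exact ⟨0, ⟨0, h4, 0, mem_closedBall_self hε.le, add_zero 0⟩, map_zero _⟩
    · rintro _ ⟨x, hx, rfl⟩
      rw [mem_preimage, hs]
      exact hsub hx
  choose! ε hε hstep using step
  let C : ∀ k, Set (E k) := fun k => Nat.rec {0} (fun k C => s k '' (C + closedBall 0 (ε k C))) k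
  have hC (k : ℕ) : P k (C k) := by
    induction k with
    | zero =>
      refine ⟨isCompact_singleton, convex_singleton 0, ?_, rfl, ?_⟩
      · exact balanced_zero
      · rintro _ rfl
        simpa using h0
    | succ k ih => exact hstep k _ ih
  have hball (k : ℕ) : j k '' closedBall 0 (ε k (C k)) ⊆ j (k + 1) '' C (k + 1) := by
    rintro _ ⟨x, hx, rfl⟩
    exact ⟨s k x, ⟨x, ⟨0, (hC k).2.2.2.1, x, hx, zero_add x⟩, rfl⟩, hs k x⟩
  have hmono : Monotone fun k => j k '' C k := by
    refine monotone_nat_of_le_succ fun k => ?_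
    rintro _ ⟨x, hx, rfl⟩
    exact ⟨s k x, ⟨x, ⟨x, hx, 0, mem_closedBall_self (hε k _ (hC k)).le, add_zero x⟩, rfl⟩, hs k x⟩
  -- `V` is absolutely convex, lies in `U` and contains a ball of every step, so its gauge is the
  -- seminorm sought.
  set V : Set G := ⋃ k, j k '' C k
  have hVconv : Convex ℝ V := hmono.directed_le.convex_iUnion fun {k} =>
    (hC k).2.1.linear_image ((j k).restrictScalars ℝ)
  have hVbal : Balanced ℂ V := balanced_iUnion fun k => (hC k).2.2.1.image_linearMap (j k)
  have hVball (k : ℕ) {x : E k} (hx : ‖x‖ ≤ ε k (C k)) : j k x ∈ V :=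
    mem_iUnion.2 ⟨k + 1, hball k ⟨x, mem_closedBall_zero_iff.2 hx, rfl⟩⟩
  have hVabs : Absorbent ℝ V := by
    refine absorbent_iff_eventually_nhdsNE_zero.2 fun g => ?_
    obtain ⟨k, x, rfl⟩ := hj g
    have ht : Tendsto (fun c : ℝ => ‖c • x‖) (𝓝[≠] 0) (𝓝 0) := by
      have : Continuous fun c : ℝ => ‖c • x‖ := by fun_prop
      simpa using (this.tendsto 0).mono_left nhdsWithin_le_nhds
    filter_upwards [ht.eventually_lt_const (hε k _ (hC k))] with c hc
    have := hVball k hc.le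
    rwa [← LinearMap.coe_restrictScalars ℝ (j k), map_smul] at this
  refine ⟨gaugeSeminorm hVbal hVconv hVabs, fun k => ?_, fun g hg => ?_⟩
  · refine Seminorm.continuous' (r := 1) ?_
    filter_upwards [closedBall_mem_nhds (0 : E k) (hε k _ (hC k))] with x hx
    rw [Seminorm.mem_closedBall_zero]
    exact gauge_le_one_of_mem (hVball k (mem_closedBall_zero_iff.1 hx))
  · have hgV : g ∈ V := setOfPred_gauge_lt_one_subset_self hVconv hVabs.zero_mem hVabs
      ((Seminorm.mem_ball_zero _).1 hg)
    obtain ⟨k, x, hx, rfl⟩ := mem_iUnion.1 hgV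
    exact (hC k).2.2.2.2 hx

end CompactSteps

/-! ### The topology of `Exp n` is determined by its traces -/

namespace ExpType

variable {n : ℕ}

theorem continuous_incl {A : ℝ} (hA : 0 < A) : Continuous (incl n A hA) :=
  (isCompatible_expTopology n).2.2.2 A hA

instance : IsTopologicalAddGroup (Exp n) := (isCompatible_expTopology n).1

/-- A seminorm on `Exp(ℂⁿ)` is continuous as soon as it is so on every `E_A`. -/
theorem ball_mem_nhds_of_continuous_comp_incl (p : Seminorm ℂ (Exp n))
    (hp : ∀ (A : ℝ) (hA : 0 < A), Continuous (p.comp (incl n A hA))) :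
    p.ball 0 1 ∈ 𝓝 (0 : Exp n) := by
  -- The topology of `p` alone is one of those over which the infimum is taken.
  let q : SeminormFamily ℂ (Exp n) (Fin 1) := fun _ => p
  let t : TopologicalSpace (Exp n) := q.moduleFilterBasis.topology
  have hq : @WithSeminorms _ _ _ _ _ _ q t := @WithSeminorms.mk _ _ _ _ _ _ q t rfl
  have ht : IsCompatible n t := by
    refine ⟨@WithSeminorms.topologicalAddGroup _ _ _ _ _ _ t q hq,
      @WithSeminorms.continuousSMul _ _ _ _ _ _ t q hq, ?_, fun A hA => ?_⟩
    · let := Module.complexToReal (Exp n)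
      exact @WithSeminorms.toLocallyConvexSpace _ _ _ _ _ _ _ _ _ t q hq
    · exact WithSeminorms.continuous_of_continuous_comp hq (incl n A hA) fun _ => hp A hA
  have hle : expTopology n ≤ t := sInf_le ht
  have hmem : p.ball 0 1 ∈ @nhds _ t 0 := by
    refine (@WithSeminorms.mem_nhds_iff _ _ _ _ _ _ t q hq _ _).2 ⟨{0}, 1, one_pos, ?_⟩
    rw [Finset.sup_singleton]
  exact nhds_mono hle hmem

/-- A subset of `Exp(ℂⁿ)` is open as soon as its traces on the `E_A` are. -/
theorem isOpen_of_isOpen_preimage_incl {U : Set (Exp n)}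
    (hU : ∀ (A : ℝ) (hA : 0 < A), IsOpen (incl n A hA ⁻¹' U)) : IsOpen U := by
  refine isOpen_iff_mem_nhds.2 fun x hx => ?_
  obtain ⟨A, hA, hxA⟩ := x.2
  -- Starting the sequence of steps at an `A` with `x ∈ E n A` allows translation by `x` on every
  -- step.
  have hAk (k : ℕ) : 0 < A + k := by positivity
  have hk (k : ℕ) : A + k ≤ A + (k + 1 : ℕ) := by push_cast; linarith
  obtain ⟨p, hp, hpU⟩ := exists_seminorm_ball_subset_of_compact_steps
    (fun k : ℕ => incl n (A + k) (hAk k)) (fun k => E.inclusion n (hk k)) (fun k f => rfl)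
    (fun k r => isCompact_image_inclusion_closedBall (hAk k).le (by push_cast; linarith) r)
    (fun g => by
      obtain ⟨B, hB, hg⟩ := g.2
      obtain ⟨k, hk⟩ := exists_nat_ge B
      exact ⟨k, ⟨g.1, growth_mono n (by linarith) hg⟩, rfl⟩)
    (U := (fun y => x + y) ⁻¹' U)
    (fun k => by
      let xk : E n (A + k) := ⟨x.1, growth_mono n (by simp) hxA⟩
      exact (hU _ (hAk k)).preimage (continuous_const_add xk))
    (by simpa using hx)
  have hp' : p.ball 0 1 ∈ 𝓝 (0 : Exp n) :=
    ball_mem_nhds_of_continuous_comp_incl p fun B hB => by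
      obtain ⟨k, hk⟩ := exists_nat_ge B
      exact (hp k).comp (E.inclusion n (show B ≤ A + k by linarith)).continuous
  have h : (fun y => x + y) ⁻¹' U ∈ 𝓝 (0 : Exp n) := mem_of_superset hp' hpU
  rw [← map_add_left_nhds_zero x]
  exact h

theorem isClosed_iff_isClosed_preimage_incl {C : Set (Exp n)} :
    IsClosed C ↔ ∀ (A : ℝ) (hA : 0 < A), IsClosed (incl n A hA ⁻¹' C) := by
  refine ⟨fun h A hA => h.preimage (continuous_incl hA), fun h => ?_⟩
  exact isOpen_compl_iff.1 (isOpen_of_isOpen_preimage_incl fun A hA => (h A hA).isOpen_compl)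

/-- Evaluation at a point is continuous on `Exp(ℂⁿ)`. -/
theorem continuous_eval (z : EuclideanSpace ℂ (Fin n)) : Continuous fun f : Exp n => f.1 z := by
  refine continuous_def.2 fun V hV => isOpen_of_isOpen_preimage_incl fun A hA => ?_
  let e : E n A →ₗ[ℂ] ℂ :=
    { toFun := fun f => f.1 z, map_add' := fun _ _ => rfl, map_smul' := fun _ _ => rfl }
  have he : Continuous e := (e.mkContinuous (Real.exp (A * ‖z‖)) fun f =>
    (E.norm_apply_le f z).trans_eq (mul_comm _ _)).continuous
  exact hV.preimage he

instance : T2Space (Exp n) :=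
  T2Space.of_injective_continuous (f := fun f : Exp n => f.1) Subtype.val_injective
    (continuous_pi continuous_eval)

end ExpType

/-! ### Division by a polynomial -/

section Division

open Polynomial in
/-- **Malgrange's inequality**: if `q` is a polynomial of degree at most `m`, with coefficient `a`
at degree `m`, and `g` is entire, then `|a| |g(0)|` is at most the maximum of `|q g|` over the unit
circle. -/
theorem Polynomial.norm_coeff_mul_le_of_forall_sphere {q : ℂ[X]} {m : ℕ} (hq : q.natDegree ≤ m)
    {g : ℂ → ℂ} (hg : Differentiable ℂ g) {M : ℝ}
    (hM : ∀ t, ‖t‖ = 1 → ‖q.eval t * g t‖ ≤ M) : ‖q.coeff m‖ * ‖g 0‖ ≤ M := by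
  -- With conjugated and reversed coefficients, `q'` has the modulus of `q` on the unit circle and
  -- that of the coefficient `a` at 0. The maximum principle is applied to `q' * g`.
  let q' : ℂ[X] := reflect m (q.map (starRingEnd ℂ))
  have hq' (t : ℂ) (ht : ‖t‖ = 1) : ‖q'.eval t‖ = ‖q.eval t‖ := by
    have ht0 : t ≠ 0 := norm_ne_zero_iff.1 (by rw [ht]; exact one_ne_zero)
    have hinv : t⁻¹ = starRingEnd ℂ t := by
      rw [Complex.inv_def, Complex.normSq_eq_norm_sq, ht]
      simp
    let : Invertible t⁻¹ := invertibleOfNonzero (inv_ne_zero ht0)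
    have h := eval₂_reflect_mul_pow (RingHom.id ℂ) t⁻¹ m (q.map (starRingEnd ℂ))
      (natDegree_map_le.trans hq)
    rw [invOf_eq_inv, inv_inv] at h
    have h' := congrArg norm h
    rw [norm_mul, norm_pow, norm_inv, ht, inv_one, one_pow, mul_one, hinv] at h'
    change ‖q'.eval t‖ = ‖(q.map (starRingEnd ℂ)).eval (starRingEnd ℂ t)‖ at h'
    rw [h', eval_map_apply, RCLike.norm_conj]
  have hcoeff : ‖q'.eval 0‖ = ‖q.coeff m‖ := by
    rw [← coeff_zero_eq_eval_zero, coeff_reflect, revAt_le (Nat.zero_le m), Nat.sub_zero,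
      coeff_map, RCLike.norm_conj]
  have hd : DiffContOnCl ℂ (fun t => q'.eval t * g t) (ball 0 1) :=
    (q'.differentiable.mul hg).diffContOnCl
  have := Complex.norm_le_of_forall_mem_frontier_norm_le (U := ball 0 1) isBounded_ball hd (C := M)
    (fun t ht => by
      rw [frontier_ball _ one_ne_zero, mem_sphere_zero_iff_norm] at ht
      rw [norm_mul, hq' t ht, ← norm_mul]
      exact hM t ht) (subset_closure (mem_ball_self one_pos))
  rwa [norm_mul, hcoeff] at this

namespace MvPolynomial

variable {σ R : Type*} [CommRing R]

/-- The restriction of a polynomial to the line `t ↦ z + t v`. -/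
noncomputable def restrictLine (z v : σ → R) : MvPolynomial σ R →ₐ[R] Polynomial R :=
  aeval fun i => Polynomial.C (z i) + Polynomial.C (v i) * Polynomial.X

theorem eval_restrictLine (z v : σ → R) (p : MvPolynomial σ R) (t : R) :
    (restrictLine z v p).eval t = eval (fun i => z i + t * v i) p := by
  induction p using MvPolynomial.induction_on with
  | C a => simp [restrictLine]
  | add p q hp hq => simp [hp, hq]
  | mul_X p i hp =>
    have hX : restrictLine z v (X i) = Polynomial.C (z i) + Polynomial.C (v i) * Polynomial.X := by
      simp [restrictLine]
    rw [map_mul, map_mul, hX, Polynomial.eval_mul, hp]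
    simp [mul_comm t]

theorem restrictLine_monomial (z v : σ → R) (s : σ →₀ ℕ) :
    (restrictLine z v (monomial s 1)).natDegree ≤ s.degree ∧
    (restrictLine z v (monomial s 1)).coeff s.degree = eval v (monomial s 1) := by
  induction s using Finsupp.induction_linear with
  | zero => simp [restrictLine]
  | add s t hs ht =>
    have h : monomial (s + t) (1 : R) = monomial s 1 * monomial t 1 := by simp
    rw [h, map_mul, map_add, map_mul]
    refine ⟨Polynomial.natDegree_mul_le_of_le hs.1 ht.1, ?_⟩
    rw [Polynomial.coeff_mul_add_eq_of_natDegree_le hs.1 ht.1, hs.2, ht.2]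
  | single i k =>
    have h : restrictLine z v (monomial (Finsupp.single i k) 1) =
        (Polynomial.C (z i) + Polynomial.C (v i) * Polynomial.X) ^ k := by
      simp [restrictLine, aeval_monomial]
    have h1 : (Polynomial.C (z i) + Polynomial.C (v i) * Polynomial.X).natDegree ≤ 1 := by
      compute_degree
    rw [h, Finsupp.degree_single]
    refine ⟨by simpa using Polynomial.natDegree_pow_le_of_le k h1, ?_⟩
    simpa [eval_monomial] using Polynomial.coeff_pow_of_natDegree_le (m := k) h1

theorem restrictLine_eq_sum (z v : σ → R) (p : MvPolynomial σ R) :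
    restrictLine z v p =
      ∑ d ∈ p.support, Polynomial.C (p.coeff d) * restrictLine z v (monomial d 1) := by
  conv_lhs => rw [p.as_sum, map_sum]
  refine Finset.sum_congr rfl fun d _ => ?_
  rw [← mul_one (coeff d p), ← smul_eq_mul, ← smul_monomial, map_smul, Polynomial.smul_eq_C_mul,
    smul_eq_mul, mul_one]

theorem degree_le_totalDegree {p : MvPolynomial σ R} {d : σ →₀ ℕ} (hd : d ∈ p.support) :
    d.degree ≤ p.totalDegree :=
  le_totalDegree hd

theorem natDegree_restrictLine_le (z v : σ → R) (p : MvPolynomial σ R) :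
    (restrictLine z v p).natDegree ≤ p.totalDegree := by
  rw [restrictLine_eq_sum]
  exact Polynomial.natDegree_sum_le_of_forall_le _ _ fun d hd =>
    (Polynomial.natDegree_C_mul_le _ _).trans
      ((restrictLine_monomial z v d).1.trans (degree_le_totalDegree hd))

/-- The right side does not involve `z`; this makes the constant in the division estimate uniform.
-/
theorem coeff_totalDegree_restrictLine (z v : σ → R) (p : MvPolynomial σ R) :
    (restrictLine z v p).coeff p.totalDegree =
      eval v (homogeneousComponent p.totalDegree p) := by
  rw [restrictLine_eq_sum, Polynomial.finsetSum_coeff, homogeneousComponent_apply, map_sum,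
    Finset.sum_filter]
  refine Finset.sum_congr rfl fun d hd => ?_
  rw [Polynomial.coeff_C_mul]
  split_ifs with h
  · rw [← h, (restrictLine_monomial z v d).2]
    simp [eval_monomial]
  · rw [Polynomial.coeff_eq_zero_of_natDegree_lt, mul_zero]
    exact (restrictLine_monomial z v d).1.trans_lt ((degree_le_totalDegree hd).lt_of_ne h)

theorem homogeneousComponent_totalDegree_ne_zero {p : MvPolynomial σ R} (hp : p ≠ 0) :
    homogeneousComponent p.totalDegree p ≠ 0 := by
  obtain ⟨d, hd, hdeg⟩ := p.support.exists_mem_eq_sup (support_nonempty.2 hp)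
    fun s => s.sum fun _ e => e
  intro h
  have hdeg' : d.degree = p.totalDegree := hdeg.symm
  have := congrArg (coeff d) h
  rw [coeff_homogeneousComponent, if_pos hdeg', coeff_zero] at this
  exact mem_support_iff.1 hd this

end MvPolynomial

/-- For a nonzero polynomial `p` there are a point `v` and a constant `c > 0` such that
`c |g(z)|` is bounded by the maximum of `|p g|` over the circle `z + t v`, `|t| = 1`. -/
theorem MvPolynomial.exists_mul_norm_le_of_forall_circle {n : ℕ} {p : MvPolynomial (Fin n) ℂ}
    (hp : p ≠ 0) : ∃ v : EuclideanSpace ℂ (Fin n), ∃ c > 0,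
      ∀ {g : EuclideanSpace ℂ (Fin n) → ℂ}, Differentiable ℂ g → ∀ {z} {M : ℝ},
        (∀ t : ℂ, ‖t‖ = 1 → ‖eval (fun i => (z + t • v) i) p * g (z + t • v)‖ ≤ M) →
        c * ‖g z‖ ≤ M := by
  obtain ⟨v, hv⟩ : ∃ v, eval v (homogeneousComponent p.totalDegree p) ≠ 0 := by
    by_contra! h
    exact homogeneousComponent_totalDegree_ne_zero hp (MvPolynomial.funext fun v => by simp [h v])
  refine ⟨WithLp.toLp 2 v, _, norm_pos_iff.2 hv, fun {g} hg z M hM => ?_⟩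
  have h := Polynomial.norm_coeff_mul_le_of_forall_sphere
    (natDegree_restrictLine_le (fun i => z i) v p)
    (g := fun t : ℂ => g (z + t • WithLp.toLp 2 v)) (hg.comp (by fun_prop)) (M := M)
    fun t ht => by
      rw [eval_restrictLine]
      exact hM t ht
  rwa [coeff_totalDegree_restrictLine, zero_smul, add_zero] at h

end Division

/-! ### Multiplication by a polynomial -/

namespace ExpType

variable {n : ℕ}

/-- Division by a nonzero polynomial is bounded: if `p g` lies in a ball of `E_A`, then `g` lies
in a fixed multiple of that ball. -/
theorem exists_growthBall_of_mul_growthBall {p : MvPolynomial (Fin n) ℂ} (hp : p ≠ 0) {A : ℝ}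
    (hA : 0 ≤ A) : ∃ K : ℝ, 0 ≤ K ∧ ∀ {g : EuclideanSpace ℂ (Fin n) → ℂ} {r : ℝ},
      Differentiable ℂ g → 0 ≤ r →
      (∀ z, ‖MvPolynomial.eval (fun i => z i) p * g z‖ ≤ r * Real.exp (A * ‖z‖)) →
      g ∈ growthBall (EuclideanSpace ℂ (Fin n)) A (K * r) := by
  obtain ⟨v, c, hc, h⟩ := MvPolynomial.exists_mul_norm_le_of_forall_circle hp
  -- Passing from `z` to the circle `z + t • v` costs at most the factor `exp (A * ‖v‖)` in the
  -- weight.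
  refine ⟨c⁻¹ * Real.exp (A * ‖v‖), by positivity, fun {g r} hg hr hb => ⟨hg, fun z => ?_⟩⟩
  have := h hg (z := z) (M := r * Real.exp (A * (‖z‖ + ‖v‖))) fun t ht => by
    refine (hb _).trans ?_
    gcongr
    refine (norm_add_le _ _).trans_eq ?_
    rw [norm_smul, ht, one_mul]
  rw [mul_add, Real.exp_add] at this
  calc ‖g z‖ = c⁻¹ * (c * ‖g z‖) := by field_simp
    _ ≤ c⁻¹ * (r * (Real.exp (A * ‖z‖) * Real.exp (A * ‖v‖))) := by gcongr
    _ = _ := by ring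

/-- Multiplication by an element of `E_B`, as a map `E_A → E_{A + B}`. -/
noncomputable def E.mul {A B : ℝ} (h : E n B) : E n A →L[ℂ] E n (A + B) :=
  LinearMap.mkContinuous
    { toFun := fun f => ⟨f.1 * h.1, mul_mem_growth f.2 h.2⟩
      map_add' := fun f g => Subtype.ext (add_mul f.1 g.1 h.1)
      map_smul' := fun c f => Subtype.ext (smul_mul_assoc c f.1 h.1) } ‖h‖ fun f => by
    refine E.norm_le_of_apply_le fun z => ?_
    change ‖f.1 z * h.1 z‖ ≤ _
    rw [norm_mul, add_mul, Real.exp_add]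
    calc ‖f.1 z‖ * ‖h.1 z‖ ≤ (‖f‖ * Real.exp (A * ‖z‖)) * (‖h‖ * Real.exp (B * ‖z‖)) := by
          gcongr
          · exact E.norm_apply_le f z
          · exact E.norm_apply_le h z
      _ = _ := by ring

/-- If `p` lies in `E n B`, multiplication by it is bounded from `E n A` to `E n (A + B)`, and
openness is tested on the steps. -/
theorem continuous_sigma (p : MvPolynomial (Fin n) ℂ) : Continuous (sigma p) := by
  obtain ⟨B, hB, hpB⟩ := eval_mem n p
  refine continuous_def.2 fun V hV => isOpen_of_isOpen_preimage_incl fun A hA => ?_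
  let P : E n B := ⟨_, hpB⟩
  have h : sigma p ∘ incl n A hA = incl n (A + B) (add_pos hA hB) ∘ E.mul P :=
    funext fun f => mul_comm _ _
  rw [← preimage_comp, h]
  exact hV.preimage ((continuous_incl _).comp (E.mul P).continuous)

theorem isClosedMap_sigma (p : MvPolynomial (Fin n) ℂ) : IsClosedMap (sigma p) := by
  intro C hC
  rcases eq_or_ne p 0 with rfl | hp
  -- For `p = 0` the image has at most one point.
  · refine (Set.Subsingleton.finite ?_).isClosed
    rintro _ ⟨f, -, rfl⟩ _ ⟨g, -, rfl⟩
    refine Subtype.ext (funext fun z => ?_)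
    change MvPolynomial.eval _ 0 * f.1 z = MvPolynomial.eval _ 0 * g.1 z
    rw [map_zero, zero_mul, zero_mul]
  refine isClosed_iff_isClosed_preimage_incl.2 fun A hA => IsSeqClosed.isClosed fun u f hu huf => ?_
  choose g hgC hgu using hu
  obtain ⟨K, hK, hdiv⟩ := exists_growthBall_of_mul_growthBall hp hA.le
  obtain ⟨r, hr⟩ := huf.norm.bddAbove_range
  have hur (k : ℕ) : ‖u k‖ ≤ r := hr ⟨k, rfl⟩
  have hr0 : 0 ≤ r := (norm_nonneg _).trans (hur 0)
  have hgB (k : ℕ) : (g k).1 ∈ growthBall (EuclideanSpace ℂ (Fin n)) A (K * r) := by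
    obtain ⟨_, _, hd, _⟩ := (g k).2
    refine hdiv hd hr0 fun z => ?_
    have hz : MvPolynomial.eval (fun i => z i) p * (g k).1 z = (u k).1 z :=
      congrFun (congrArg Subtype.val (hgu k)) z
    rw [hz]
    exact (E.norm_apply_le (u k) z).trans (by gcongr; exact hur k)
  let gA (k : ℕ) : E n A := ⟨(g k).1, mem_growthSubmodule_of_growthBall (hgB k)⟩
  have hA1 : A < A + 1 := lt_add_one A
  have hA1' : 0 < A + 1 := by positivity
  obtain ⟨h, -, φ, hφ, hlim⟩ := (isCompact_image_inclusion_closedBall (n := n) hA.le hA1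
    (K * r)).tendsto_subseq (x := fun k => E.inclusion n hA1.le (gA k)) fun k =>
      ⟨gA k, mem_closedBall_zero_iff.2 (E.norm_le_of_apply_le (hgB k).2), rfl⟩
  have hlim' : Tendsto (fun k => g (φ k)) atTop (𝓝 (incl n (A + 1) hA1' h)) :=
    ((continuous_incl hA1').tendsto h).comp hlim
  refine ⟨incl n (A + 1) hA1' h, hC.mem_of_tendsto hlim' (.of_forall fun k => hgC (φ k)), ?_⟩
  -- Along the subsequence, the products `p * g` tend both to `p * h` and to `f`.
  refine tendsto_nhds_unique (((continuous_sigma p).tendsto _).comp hlim') ?_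
  have hf := (((continuous_incl hA).tendsto f).comp huf).comp hφ.tendsto_atTop
  exact hf.congr fun k => (hgu (φ k)).symm

theorem coe_span_ofPolynomial (p : MvPolynomial (Fin n) ℂ) :
    ((Ideal.span {ofPolynomial p} : Ideal (Exp n)) : Set (Exp n)) = range (sigma p) := by
  ext f
  rw [SetLike.mem_coe, Ideal.mem_span_singleton']
  exact exists_congr fun g => by rw [sigma, mul_comm]

end ExpType

theorem proposition3p4 (n : ℕ) (p : MvPolynomial (Fin n) ℂ) :
    Continuous (ExpType.sigma p) ∧
    IsClosedMap (ExpType.sigma p) ∧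
    IsClosed ((Ideal.span {ExpType.ofPolynomial p} : Ideal (ExpType.Exp n)) :
      Set (ExpType.Exp n)) := by
  refine ⟨ExpType.continuous_sigma p, ExpType.isClosedMap_sigma p, ?_⟩
  rw [ExpType.coe_span_ofPolynomial]
  exact (ExpType.isClosedMap_sigma p).isClosed_range
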